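/- Let $K$ be a field of characteristic $0$ and let $L$ be a finite-dimensional simple Lie algebra over $K$ (i.e. $L$ is non-abelian and its only ideals are $0$ and $L$). Call a $K$-linear operator $J : L \to L$ Lie-orthogonal if $[Jx, Jy] = [x, y]$ for all $x, y \in L$. Then a $K$-linear operator $J$ on $L$ is Lie-orthogonal if and only if $J = \mathrm{Id}_L$ or $J = -\mathrm{Id}_L$. -/

import Mathlib

/-- A linear operator `J` on a Lie algebra `L` over a field `K` is *Lie-orthogonal* if
`⁅J x, J y⁆ = ⁅x, y⁆` for all `x, y` in `L`. No invertibility is required. -/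
def IsLieOrthogonal {K L : Type*} [Field K] [LieRing L] [LieAlgebra K L]
    (J : L →ₗ[K] L) : Prop :=
  ∀ x y : L, ⁅J x, J y⁆ = ⁅x, y⁆

namespace IsLieOrthogonal

variable {K L : Type*} [Field K] [LieRing L] [LieAlgebra K L] {J : L →ₗ[K] L}

/-! Invariance of the nondegenerate Killing form forces `J ^ 2 = 1`, so `L` splits into the ±1
eigenspaces of `J`, which commute. The +1 eigenspace is then an ideal, and simplicity makes it `0`
or `L`. -/

theorem injective (hJ : IsLieOrthogonal J) (hc : LieAlgebra.center K L = ⊥) :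
    Function.Injective J := by
  rw [injective_iff_map_eq_zero]
  intro x hx
  have hmem : x ∈ LieAlgebra.center K L := by
    rw [LieModule.mem_maxTrivSubmodule]
    intro y
    rw [← hJ y x, hx, lie_zero]
  rwa [hc, LieSubmodule.mem_bot] at hmem

/-- Invariance of the Killing form makes a surjective Lie-orthogonal operator an involution as soon
as only `0` is Killing-orthogonal to every bracket. -/
theorem involutive (hJ : IsLieOrthogonal J) (hs : Function.Surjective J)
    (h : ∀ x : L, (∀ y z : L, killingForm K L x ⁅y, z⁆ = 0) → x = 0) :
    Function.Involutive J := by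
  have inv (x y z : L) : killingForm K L ⁅x, y⁆ z = killingForm K L x ⁅y, z⁆ :=
    LieModule.traceForm_apply_lie_apply K L L x y z
  have left (x y z : L) : killingForm K L (J x) ⁅J y, z⁆ = killingForm K L x ⁅y, z⁆ := by
    rw [← inv, hJ, inv]
  have shift (x y z : L) : killingForm K L (J x) ⁅y, z⁆ = killingForm K L x ⁅y, J z⁆ := by
    obtain ⟨u, rfl⟩ := hs y
    rw [left, hJ]
  intro x
  refine sub_eq_zero.mp (h _ fun y z ↦ ?_)
  rw [map_sub, LinearMap.sub_apply, shift, ← lie_skew y (J z), map_neg, left, ← map_neg, lie_skew,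
    sub_self]

theorem lie_apply_comm (hJ : IsLieOrthogonal J) (hi : Function.Involutive J) (x y : L) :
    ⁅J x, y⁆ = ⁅x, J y⁆ := by
  rw [← hJ x (J y), hi]

/-- Fixed points commute with points that are negated. -/
theorem lie_eq_zero [CharZero K] (hJ : IsLieOrthogonal J) {x y : L} (hx : J x = x)
    (hy : J y = -y) : ⁅x, y⁆ = 0 := by
  have h := hJ x y
  rw [hx, hy, lie_neg, neg_eq_iff_add_eq_zero, ← two_smul K] at h
  exact (smul_eq_zero_iff_right two_ne_zero).mp h

theorem apply_lie_eq_of_apply_eq [CharZero K] (hJ : IsLieOrthogonal J)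
    (hi : Function.Involutive J) (hc : LieAlgebra.center K L = ⊥) (y : L) {m : L} (hm : J m = m) :
    J ⁅y, m⁆ = ⁅y, m⁆ := by
  have two {a : L} (h : (2 : K) • a = 0) : a = 0 := (smul_eq_zero_iff_right two_ne_zero).mp h
  have fixed (z : L) : J (z + J z) = z + J z := by rw [map_add, hi, add_comm]
  have negated (z : L) : J (z - J z) = -(z - J z) := by rw [map_sub, hi, neg_sub]
  -- `2⁅y, m⁆` is a bracket of two fixed points, so Jacobi applies.
  have comm {z : L} (hz : J z = -z) : ⁅⁅y, m⁆, z⁆ = 0 := by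
    apply two
    have hy : (2 : K) • ⁅y, m⁆ = ⁅y + J y, m⁆ := by
      rw [add_lie, lie_apply_comm hJ hi, hm, two_smul]
    rw [← smul_lie, hy, lie_lie, lie_eq_zero hJ hm hz, lie_eq_zero hJ (fixed y) hz, lie_zero,
      lie_zero, sub_zero]
  -- This difference is negated by `J`, so it commutes with fixed points; `comm` handles negated
  -- ones.
  have hmem : ⁅y, m⁆ - J ⁅y, m⁆ ∈ LieAlgebra.center K L := by
    rw [LieModule.mem_maxTrivSubmodule]
    intro z
    apply two
    have hz : (2 : K) • z = (z + J z) + (z - J z) := by rw [two_smul]; abel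
    have h₂ : ⁅⁅y, m⁆ - J ⁅y, m⁆, z - J z⁆ = 0 := by
      rw [sub_lie, lie_apply_comm hJ hi, negated, lie_neg, comm (negated z), neg_zero, sub_zero]
    rw [← smul_lie, hz, add_lie, lie_eq_zero hJ (fixed z) (negated _), ← lie_skew, h₂, neg_zero,
      add_zero]
  rw [hc, LieSubmodule.mem_bot] at hmem
  exact (sub_eq_zero.mp hmem).symm

/-- The fixed points of an involutive Lie-orthogonal operator on a centreless Lie algebra form an
ideal. -/
def fixedIdeal [CharZero K] (hJ : IsLieOrthogonal J) (hi : Function.Involutive J)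
    (hc : LieAlgebra.center K L = ⊥) : LieIdeal K L where
  __ := LinearMap.eqLocus J LinearMap.id
  lie_mem {y _} hm := apply_lie_eq_of_apply_eq hJ hi hc y hm

theorem mem_fixedIdeal [CharZero K] {hJ : IsLieOrthogonal J} {hi : Function.Involutive J}
    {hc : LieAlgebra.center K L = ⊥} {x : L} : x ∈ fixedIdeal hJ hi hc ↔ J x = x :=
  Iff.rfl

end IsLieOrthogonal

/-- By invariance each `⁅x, y⁆` lies in the Killing radical, which is zero, so `x` is central. -/
theorem LieAlgebra.IsSimple.eq_zero_of_killingForm_lie_eq_zero {K L : Type*} [Field K] [CharZero K]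
    [LieRing L] [LieAlgebra K L] [FiniteDimensional K L] [LieAlgebra.IsSimple K L] (x : L)
    (h : ∀ y z : L, killingForm K L x ⁅y, z⁆ = 0) : x = 0 := by
  have hmem : x ∈ LieAlgebra.center K L := by
    rw [LieModule.mem_maxTrivSubmodule]
    intro y
    rw [← lie_skew, neg_eq_zero]
    have hker : ⁅x, y⁆ ∈ LieIdeal.killingCompl K L ⊤ := by
      rw [LieIdeal.mem_killingCompl]
      intro z _
      rw [LieModule.traceForm_comm, LieModule.traceForm_apply_lie_apply]
      exact h y z
    rwa [LieAlgebra.IsKilling.killingCompl_top_eq_bot, LieSubmodule.mem_bot] at hker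
  rwa [LieAlgebra.center_eq_bot, LieSubmodule.mem_bot] at hmem

theorem theorem2 {K L : Type*} [Field K] [CharZero K] [LieRing L] [LieAlgebra K L]
    [FiniteDimensional K L] [LieAlgebra.IsSimple K L] (J : L →ₗ[K] L) :
    IsLieOrthogonal J ↔ J = LinearMap.id ∨ J = -LinearMap.id := by
  constructor
  · intro hJ
    have hc : LieAlgebra.center K L = ⊥ := LieAlgebra.center_eq_bot K L
    have hi : Function.Involutive J :=
      hJ.involutive (LinearMap.injective_iff_surjective.mp (hJ.injective hc))
        LieAlgebra.IsSimple.eq_zero_of_killingForm_lie_eq_zero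
    rcases LieAlgebra.IsSimple.eq_bot_or_eq_top (R := K) (IsLieOrthogonal.fixedIdeal hJ hi hc)
      with hI | hI
    · right
      ext x
      -- `x + J x` is always fixed, as `J` is an involution.
      have hx : x + J x ∈ IsLieOrthogonal.fixedIdeal hJ hi hc := by
        rw [IsLieOrthogonal.mem_fixedIdeal, map_add, hi, add_comm]
      rw [hI, LieSubmodule.mem_bot] at hx
      exact (neg_eq_of_add_eq_zero_right hx).symm
    · left
      ext x
      exact IsLieOrthogonal.mem_fixedIdeal.mp (hI ▸ LieSubmodule.mem_top x)
  · rintro (rfl | rfl) x y <;> simp
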